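/- Setting. Fix a set of letters. For a finite alphabet $\Sigma$ of such letters and infinitely many string variables $x_1,x_2,\dots$, a basic string term is a variable or a word in $\Sigma^*$, and an extended string term is a word over variables and letters of $\Sigma$. Consider quantifier-free Boolean combinations (using $\neg,\land,\lor,\Rightarrow,\Leftrightarrow$) of atoms of the following types: word equations $s_1=s_2$ between extended string terms (WE); membership constraints $s\in R$ with $s$ an extended string term and $R\subseteq\Sigma^*$ regular (REG); length constraints $\ell_1=\ell_2$, where each $\ell_i$ has the form $k_0+k_1|t_1|+\dots+k_n|t_n|$ with $k_j\in\mathbb Z$ and basic string terms $t_j$ (LEN). Variables range over $\Sigma^*$. The family $\mathrm{WE+REG}$ (respectively $\mathrm{WE+LEN}$, $\mathrm{WE+REG+LEN}$) consists, for each finite alphabet $\Sigma$, of the theory of all such formulas over $\Sigma$ whose atoms are of the types named. The language expressed by a variable $x$ occurring in a formula $f$ is the set of values of $x$ under the substitutions that make $f$ true. A language is expressible in a theory if it is expressed by some variable occurring in some formula of the theory, and expressible in a family if it is expressible in some theory of the family. For theories, $T_1\preceq T_2$ means that every language expressible in $T_1$ is expressible in $T_2$; for families, $F_1\preceq F_2$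 means that for every $T_1\in F_1$ there is $T_2\in F_2$ with $T_1\preceq T_2$; and $F_1\prec F_2$ means that $F_1\preceq F_2$ but not $F_2\preceq F_1$. Lemma. Let $a,b,c$ be distinct letters. (1) The language $\{vc : v\in\{a,b\}^*\}$ is expressible in $\mathrm{WE+REG}$ (over every finite alphabet containing $a,b,c$), but not in $\mathrm{WE+LEN}$ (over any finite alphabet). (2) The language $\{ucv : u,v\in\{a,b,c\}^*,\ |u|=|v|\}$ is expressible in $\mathrm{WE+LEN}$ (over the alphabet $\{a,b,c\}$), but not in $\mathrm{WE+REG}$ (over any finite alphabet). Consequently neither of the classes of languages expressible in $\mathrm{WE+LEN}$ and in $\mathrm{WE+REG}$ contains the other, neither $\mathrm{WE+LEN}\preceq\mathrm{WE+REG}$ nor $\mathrm{WE+REG}\preceq\mathrm{WE+LEN}$ holds, and $\mathrm{WE+LEN}\prec\mathrm{WE+REG+LEN}$ and $\mathrm{WE+REG}\prec\mathrm{WE+REG+LEN}$. -/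

import Mathlib

namespace StringLogic

universe u

/-- Basic string terms over the alphabet `A`: a variable (the variables are indexed by `ℕ`)
or a concrete word. -/
abbrev BasicTerm (A : Type u) : Type u := ℕ ⊕ List A

/-- Extended string terms over the alphabet `A`: words over variables and letters. -/
abbrev ExtTerm (A : Type u) : Type u := List (ℕ ⊕ A)

/-- Length terms `k₀ + k₁|s₁| + ⋯ + kₙ|sₙ|` with integer coefficients and basic string terms. -/
structure LenTerm (A : Type u) : Type u where
  const : ℤ
  summands : List (ℤ × BasicTerm A)

/-- The three types of atoms: language membership `s ∈ L`, equality of length terms `ℓ₁ = ℓ₂`,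
and word equations `s₁ = s₂`. -/
inductive Atom (A : Type u) : Type u where
  | mem (s : ExtTerm A) (L : Language A)
  | len (l₁ l₂ : LenTerm A)
  | eq (s₁ s₂ : ExtTerm A)

/-- Quantifier-free formulas: Boolean combinations of atoms. -/
inductive Formula (A : Type u) : Type u where
  | atom (α : Atom A)
  | not (f : Formula A)
  | and (f g : Formula A)
  | or (f g : Formula A)
  | imp (f g : Formula A)
  | iff (f g : Formula A)

section Semantics

variable {A : Type u}

/-- Value of a basic string term under the substitution `h`. -/
def BasicTerm.eval (h : ℕ → List A) : BasicTerm A → List A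
  | Sum.inl x => h x
  | Sum.inr w => w

/-- Value of an extended string term: the image under the morphism that extends `h` and fixes
all letters. -/
def ExtTerm.eval (h : ℕ → List A) (s : ExtTerm A) : List A :=
  s.flatMap (Sum.elim h (fun a => [a]))

/-- Value of a length term. -/
def LenTerm.eval (h : ℕ → List A) (l : LenTerm A) : ℤ :=
  l.const + (l.summands.map (fun p => p.1 * ((BasicTerm.eval h p.2).length : ℤ))).sum

/-- Truth of an atom under a substitution. -/
def Atom.Holds (h : ℕ → List A) : Atom A → Prop
  | .mem s L => ExtTerm.eval h s ∈ L
  | .len l₁ l₂ => l₁.eval h = l₂.eval h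
  | .eq s₁ s₂ => ExtTerm.eval h s₁ = ExtTerm.eval h s₂

/-- Truth of a formula under a substitution. -/
def Formula.Holds (h : ℕ → List A) : Formula A → Prop
  | .atom α => α.Holds h
  | .not f => ¬ f.Holds h
  | .and f g => f.Holds h ∧ g.Holds h
  | .or f g => f.Holds h ∨ g.Holds h
  | .imp f g => f.Holds h → g.Holds h
  | .iff f g => (f.Holds h ↔ g.Holds h)

/-- `f.HasAtom α`: the atom `α` occurs in the formula `f`. -/
def Formula.HasAtom (α : Atom A) : Formula A → Prop
  | .atom β => α = β
  | .not f => f.HasAtom α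
  | .and f g => f.HasAtom α ∨ g.HasAtom α
  | .or f g => f.HasAtom α ∨ g.HasAtom α
  | .imp f g => f.HasAtom α ∨ g.HasAtom α
  | .iff f g => f.HasAtom α ∨ g.HasAtom α

/-- The variable `x` occurs in a length term. -/
def LenTerm.HasVar (x : ℕ) (l : LenTerm A) : Prop :=
  ∃ p ∈ l.summands, p.2 = Sum.inl x

/-- The variable `x` occurs in an atom. -/
def Atom.HasVar (x : ℕ) : Atom A → Prop
  | .mem s _ => Sum.inl x ∈ s
  | .len l₁ l₂ => l₁.HasVar x ∨ l₂.HasVar x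
  | .eq s₁ s₂ => Sum.inl x ∈ s₁ ∨ Sum.inl x ∈ s₂

/-- The variable `x` occurs in a formula. -/
def Formula.HasVar (x : ℕ) (f : Formula A) : Prop :=
  ∃ α, f.HasAtom α ∧ α.HasVar x

/-- Regular language membership constraints. -/
def Atom.IsREG : Atom A → Prop
  | .mem _ L => L.IsRegular
  | _ => False

/-- Length constraints. -/
def Atom.IsLEN : Atom A → Prop
  | .len _ _ => True
  | _ => False

/-- Word equations. -/
def Atom.IsWE : Atom A → Prop
  | .eq _ _ => True
  | _ => False

end Semantics

section Theories

/-- A theory over the underlying alphabet `A`, as a set of formulas. -/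
abbrev TheoryOver (A : Type u) : Type u := Set (Formula A)

/-- A family of theories: one theory for each finite alphabet of letters from `Λ`. -/
abbrev Family (Λ : Type u) : Type u := (S : Finset Λ) → TheoryOver S

variable {Λ : Type u}

/-- The family `WE+REG`. -/
def weReg : Family Λ := fun _ => {f | ∀ α, f.HasAtom α → α.IsWE ∨ α.IsREG}

/-- The family `WE+LEN`. -/
def weLen : Family Λ := fun _ => {f | ∀ α, f.HasAtom α → α.IsWE ∨ α.IsLEN}

/-- The family `WE+REG+LEN`. -/
def weRegLen : Family Λ := fun _ => {f | ∀ α, f.HasAtom α → α.IsWE ∨ α.IsREG ∨ α.IsLEN}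

/-- The language expressed by the variable `x` in the formula `f` with underlying alphabet `S`:
the values of `x` under satisfying substitutions, regarded as words over the universe `Λ` of
letters, so that languages expressed over different alphabets can be compared. -/
def Formula.expressed {S : Finset Λ} (f : Formula S) (x : ℕ) : Language Λ :=
  {w | ∃ h : ℕ → List S, f.Holds h ∧ w = (h x).map Subtype.val}

/-- `L` is expressible in the theory `T`: some variable occurring in some formula of `T`
expresses it. -/
def Expressible {S : Finset Λ} (T : TheoryOver S) (L : Language Λ) : Prop :=
  ∃ f ∈ T, ∃ x, f.HasVar x ∧ f.expressed x = L

/-- `L` is expressible in the family `F`: it is expressible in some theory of `F`. -/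
def Family.Expressible (F : Family Λ) (L : Language Λ) : Prop :=
  ∃ S, StringLogic.Expressible (F S) L

/-- `T₁ ≼ T₂` for theories, possibly over different alphabets. -/
def TheoryLE {S₁ S₂ : Finset Λ} (T₁ : TheoryOver S₁) (T₂ : TheoryOver S₂) : Prop :=
  ∀ f ∈ T₁, ∀ x, f.HasVar x → ∃ f' ∈ T₂, ∃ x', f'.HasVar x' ∧ f.expressed x = f'.expressed x'

/-- `F₁ ≼ F₂` for families of theories. -/
def Family.LE (F₁ F₂ : Family Λ) : Prop :=
  ∀ S₁, ∃ S₂, TheoryLE (F₁ S₁) (F₂ S₂)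

/-- `F₁ ∼ F₂`. -/
def Family.Equiv (F₁ F₂ : Family Λ) : Prop := F₁.LE F₂ ∧ F₂.LE F₁

/-- `F₁ ≺ F₂`. -/
def Family.LT (F₁ F₂ : Family Λ) : Prop := F₁.LE F₂ ∧ ¬ F₁.Equiv F₂

/-- The class of languages expressible in the family `F`. -/
def Family.languages (F : Family Λ) : Set (Language Λ) := {L | F.Expressible L}

/-- The language `{v c | v ∈ {a,b}*}`. -/
def abStarC (a b c : Λ) : Language Λ :=
  {w | ∃ v : List Λ, (∀ l ∈ v, l = a ∨ l = b) ∧ w = v ++ [c]}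

/-- The language `{u c v | u, v ∈ {a,b,c}*, |u| = |v|}`. -/
def centralC (a b c : Λ) : Language Λ :=
  {w | ∃ u v : List Λ, (∀ l ∈ u, l = a ∨ l = b ∨ l = c) ∧ (∀ l ∈ v, l = a ∨ l = b ∨ l = c) ∧
    u.length = v.length ∧ w = u ++ [c] ++ v}

end Theories

end StringLogic

/-! Both inexpressibility results come from one exchange argument. Fix the letter `a` as a separator
and let `σ n` swap two `a`-free words, the pairs for different `n` being disjoint. `blockMap a (σ
n)` applies this swap to every maximal `a`-free block; it is an involution on words.

It need not be multiplicative, but it can fail only at a cut where `σ n` moves one of the two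
adjacent blocks or their concatenation. A formula has a fixed number of cuts and each word is moved
by at most one `σ n`, so the number of bad `n` is bounded independently of the substitution. For any
other `n`, word equations keep their truth value by injectivity, length atoms do if `σ n` preserves
length, and membership atoms do if the swapped words are syntactically congruent
(`Formula.exists_holds_blockMap`).

It remains to choose a word of the language in which every candidate swap does damage. Against
`WE+LEN`, swapping `b^(n+2)` with `c^(n+2)` creates extra letters `c`. Against `WE+REG`, swapping
two powers of `b` that no occurring regular language distinguishes changes the length to the left of
the central `c` only. -/

namespace StringLogic

open List

/-! ### Maps acting on the `a`-free blocks of a word -/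

section BlockMap

variable {A : Type*} [DecidableEq A]

/-- Apply `σ` to the maximal `a`-free blocks of a word, where `acc` is the part of the first
block that has been read already. -/
def blockMapAux (a : A) (σ : List A → List A) : List A → List A → List A
  | acc, [] => σ acc
  | acc, l :: ls =>
    if l = a then σ acc ++ a :: blockMapAux a σ [] ls else blockMapAux a σ (acc ++ [l]) ls

/-- Apply `σ` to the maximal `a`-free blocks of a word. -/
def blockMap (a : A) (σ : List A → List A) (w : List A) : List A := blockMapAux a σ [] w

variable {a : A} {σ : List A → List A}

theorem blockMapAux_append_of_notMem {u : List A} (hu : a ∉ u) (acc w : List A) :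
    blockMapAux a σ acc (u ++ w) = blockMapAux a σ (acc ++ u) w := by
  induction u generalizing acc with
  | nil => simp
  | cons l u ih =>
    simp only [mem_cons, not_or] at hu
    rw [cons_append, blockMapAux, if_neg (Ne.symm hu.1), ih hu.2]
    simp

theorem blockMapAux_append_cons (acc x z : List A) :
    blockMapAux a σ acc (x ++ a :: z) = blockMapAux a σ acc x ++ a :: blockMap a σ z := by
  induction x generalizing acc with
  | nil => simp [blockMapAux, blockMap]
  | cons l x ih =>
    by_cases hl : l = a
    · simp [blockMapAux, hl, ih]
    · simp [blockMapAux, hl, ih]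

theorem blockMap_of_notMem {u : List A} (hu : a ∉ u) : blockMap a σ u = σ u := by
  have := blockMapAux_append_of_notMem (σ := σ) hu [] []
  simpa [blockMap, blockMapAux] using this

theorem blockMap_append_cons (x z : List A) :
    blockMap a σ (x ++ a :: z) = blockMap a σ x ++ a :: blockMap a σ z :=
  blockMapAux_append_cons [] x z

/-- Since `σ` creates no `a` inside a block, the image has the same block structure, and a second
application undoes `σ` block by block. -/
theorem blockMap_blockMapAux (hσ : Function.Involutive σ) (ha : ∀ u, a ∉ u → a ∉ σ u)
    (w : List A) {acc : List A} (hacc : a ∉ acc) :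
    blockMap a σ (blockMapAux a σ acc w) = acc ++ w := by
  induction w generalizing acc with
  | nil => simp [blockMapAux, blockMap_of_notMem (ha _ hacc), hσ acc]
  | cons l w ih =>
    by_cases hl : l = a
    · simp [blockMapAux, hl, blockMap_append_cons, blockMap_of_notMem (ha _ hacc), hσ acc, ih]
    · have : a ∉ acc ++ [l] := by simp [hacc, Ne.symm hl]
      simp [blockMapAux, hl, ih this]

theorem blockMap_involutive (hσ : Function.Involutive σ) (ha : ∀ u, a ∉ u → a ∉ σ u) :
    Function.Involutive (blockMap a σ) := fun w => by
  simpa [blockMap] using blockMap_blockMapAux hσ ha w (acc := []) (by simp)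

theorem length_blockMap (hσ : ∀ u, (σ u).length = u.length) (w : List A) :
    (blockMap a σ w).length = w.length := by
  suffices ∀ acc, (blockMapAux a σ acc w).length = acc.length + w.length by
    simpa [blockMap] using this []
  induction w with
  | nil => simp [blockMapAux, hσ]
  | cons l w ih =>
    intro acc
    by_cases hl : l = a
    · simp [blockMapAux, hl, ih, hσ]
    · simp [blockMapAux, hl, ih]; omega

/-- If `σ` respects the syntactic congruence of `L`, so does the induced map on words. -/
theorem append_blockMap_append_mem_iff {L : Language A}
    (hσ : ∀ u s t, s ++ σ u ++ t ∈ L ↔ s ++ u ++ t ∈ L) (w s t : List A) :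
    s ++ blockMap a σ w ++ t ∈ L ↔ s ++ w ++ t ∈ L := by
  suffices ∀ acc s, s ++ blockMapAux a σ acc w ++ t ∈ L ↔ s ++ acc ++ w ++ t ∈ L by
    simpa [blockMap] using this [] s
  induction w with
  | nil => simpa [blockMapAux] using fun acc s => hσ acc s t
  | cons l w ih =>
    intro acc s
    by_cases hl : l = a
    · have h₁ := ih [] (s ++ σ acc ++ [a])
      have h₂ := hσ acc s (a :: w ++ t)
      subst hl
      simp only [blockMapAux, if_true]
      simp only [append_assoc, append_nil, cons_append, nil_append] at h₁ h₂ ⊢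
      rw [h₁, h₂]
    · simpa [blockMapAux, hl] using ih (acc ++ [l]) s

theorem blockMap_mem_iff {L : Language A}
    (hσ : ∀ u s t, s ++ σ u ++ t ∈ L ↔ s ++ u ++ t ∈ L) (w : List A) :
    blockMap a σ w ∈ L ↔ w ∈ L := by
  simpa using append_blockMap_append_mem_iff (a := a) hσ w [] []

/-- The first `a`-free block of a word. -/
def firstBlock (a : A) (w : List A) : List A := w.takeWhile (· ≠ a)

/-- The last `a`-free block of a word, preceded by `acc` if it is the first block as well. -/
def lastBlock (a : A) : List A → List A → List A
  | acc, [] => acc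
  | acc, l :: ls => if l = a then lastBlock a [] ls else lastBlock a (acc ++ [l]) ls

/-- The pending prefix `acc` only influences the first block, so one remainder `r` serves all `acc`.
-/
theorem exists_blockMapAux_eq_firstBlock (a : A) (σ : List A → List A) (y : List A) :
    ∃ r, ∀ acc, blockMapAux a σ acc y = σ (acc ++ firstBlock a y) ++ r := by
  induction y with
  | nil => exact ⟨[], by simp [blockMapAux, firstBlock]⟩
  | cons l y ih =>
    by_cases hl : l = a
    · exact ⟨a :: blockMapAux a σ [] y, by simp [blockMapAux, hl, firstBlock]⟩
    · obtain ⟨r, h⟩ := ih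
      exact ⟨r, by simp [blockMapAux, hl, h, firstBlock]⟩

/-- The map on words is multiplicative at a cut where `σ` fixes the adjacent blocks and their
concatenation. -/
theorem blockMap_append {x y : List A} (h₁ : σ (lastBlock a [] x) = lastBlock a [] x)
    (h₂ : σ (firstBlock a y) = firstBlock a y)
    (h₃ : σ (lastBlock a [] x ++ firstBlock a y) = lastBlock a [] x ++ firstBlock a y) :
    blockMap a σ (x ++ y) = blockMap a σ x ++ blockMap a σ y := by
  -- Generalized over the pending block, because a letter other than `a` is moved into it by the
  -- recursion.
  suffices ∀ acc, σ (lastBlock a acc x) = lastBlock a acc x →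
      σ (lastBlock a acc x ++ firstBlock a y) = lastBlock a acc x ++ firstBlock a y →
      blockMapAux a σ acc (x ++ y) = blockMapAux a σ acc x ++ blockMapAux a σ [] y from
    this [] h₁ h₃
  clear h₁ h₃
  induction x with
  | nil =>
    intro acc h₁ h₃
    obtain ⟨r, hr⟩ := exists_blockMapAux_eq_firstBlock a σ y
    simp only [lastBlock] at h₁ h₃
    simp [blockMapAux, hr, h₁, h₂, h₃]
  | cons l x ih =>
    intro acc h₁ h₃
    by_cases hl : l = a
    · simp only [lastBlock, hl, if_true] at h₁ h₃
      simp [blockMapAux, hl, ih [] h₁ h₃]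
    · simp only [lastBlock, hl, if_false] at h₁ h₃
      simp [blockMapAux, hl, ih _ h₁ h₃]

theorem blockMap_flatMap_append {ι : Type*} (l : List ι) (g : ι → List A)
    (hg : ∀ i, a ∉ g i) (z : List A) :
    blockMap a σ (l.flatMap (fun i => g i ++ [a]) ++ z) =
      l.flatMap (fun i => σ (g i) ++ [a]) ++ blockMap a σ z := by
  induction l with
  | nil => simp
  | cons i l ih =>
    have := blockMap_append_cons (a := a) (σ := σ) (g i)
      (l.flatMap (fun i => g i ++ [a]) ++ z)
    simp only [flatMap_cons, append_assoc, cons_append, nil_append]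
    rw [this, ih, blockMap_of_notMem (hg i)]

theorem blockMap_replicate (h : σ [] = []) (k : ℕ) :
    blockMap a σ (replicate k a) = replicate k a := by
  induction k with
  | zero => simpa [blockMap, blockMapAux] using h
  | succ k ih => simpa [blockMap, blockMapAux, replicate_succ, h] using ih

theorem blockMap_cons_replicate {c : A} (hc : c ≠ a) (h : σ [] = []) (hσ : σ [c] = [c])
    (k : ℕ) : blockMap a σ (c :: replicate k a) = c :: replicate k a := by
  have ha : a ∉ [c] := by simpa using hc.symm
  cases k with
  | zero => simpa [hσ] using blockMap_of_notMem (σ := σ) ha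
  | succ k =>
    have := blockMap_append_cons (a := a) (σ := σ) [c] (replicate k a)
    rw [blockMap_of_notMem ha, hσ, blockMap_replicate h] at this
    simpa [replicate_succ] using this

end BlockMap

/-! ### Invariance of formulas under almost all block maps -/

section Transfer

variable {A : Type*}

theorem Formula.holds_congr {h h' : ℕ → List A} (f : Formula A)
    (H : ∀ α, f.HasAtom α → (α.Holds h ↔ α.Holds h')) : f.Holds h ↔ f.Holds h' := by
  induction f with
  | atom α => exact H α rfl
  | not f ih => exact not_congr (ih H)
  | and f g ihf ihg =>
    exact and_congr (ihf fun α hα => H α (.inl hα)) (ihg fun α hα => H α (.inr hα))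
  | or f g ihf ihg =>
    exact or_congr (ihf fun α hα => H α (.inl hα)) (ihg fun α hα => H α (.inr hα))
  | imp f g ihf ihg =>
    exact imp_congr (ihf fun α hα => H α (.inl hα)) (ihg fun α hα => H α (.inr hα))
  | iff f g ihf ihg =>
    exact iff_congr (ihf fun α hα => H α (.inl hα)) (ihg fun α hα => H α (.inr hα))

/-- A property that atoms have for all sufficiently divisible positive integers holds for all
atoms of a formula at once. -/
theorem Formula.exists_pos_forall_atom {P : Atom A → ℕ → Prop} {Q : Atom A → Prop}
    (hP : ∀ α, Q α → ∃ p, 0 < p ∧ P α p) (hmul : ∀ α p q, 0 < q → P α p → P α (p * q))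
    (f : Formula A) (hf : ∀ α, f.HasAtom α → Q α) :
    ∃ p, 0 < p ∧ ∀ α, f.HasAtom α → P α p := by
  have key : ∀ f g : Formula A, (∃ p, 0 < p ∧ ∀ α, f.HasAtom α → P α p) →
      (∃ p, 0 < p ∧ ∀ α, g.HasAtom α → P α p) →
      ∃ p, 0 < p ∧ ∀ α, f.HasAtom α ∨ g.HasAtom α → P α p := by
    rintro f g ⟨p, hp, hfp⟩ ⟨q, hq, hgq⟩
    refine ⟨p * q, Nat.mul_pos hp hq, fun α hα => ?_⟩
    rcases hα with hα | hα
    · exact hmul _ _ _ hq (hfp α hα)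
    · rw [mul_comm]
      exact hmul _ _ _ hp (hgq α hα)
  induction f with
  | atom α =>
    obtain ⟨p, hp, h⟩ := hP α (hf α rfl)
    exact ⟨p, hp, fun β hβ => by rw [show β = α from hβ]; exact h⟩
  | not f ih => exact ih hf
  | and f g ihf ihg | or f g ihf ihg | imp f g ihf ihg | iff f g ihf ihg =>
    exact key f g (ihf fun α hα => hf α (.inl hα)) (ihg fun α hα => hf α (.inr hα))

variable [DecidableEq A] {a : A} {σ : ℕ → List A → List A} {κ : List A → ℕ}

/-- `blockMap a σ` commutes with the evaluation of the extended terms in `α`. -/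
def Atom.Commutes (a : A) (σ : List A → List A) (h : ℕ → List A) : Atom A → Prop
  | .mem s _ => blockMap a σ (ExtTerm.eval h s) = ExtTerm.eval (blockMap a σ ∘ h) s
  | .len _ _ => True
  | .eq s t => blockMap a σ (ExtTerm.eval h s) = ExtTerm.eval (blockMap a σ ∘ h) s ∧
      blockMap a σ (ExtTerm.eval h t) = ExtTerm.eval (blockMap a σ ∘ h) t

/-- By `hκ`, a word `u` can be moved only by the index `κ u`, so each word required to stay fixed
excludes at most one `n`. The bound `N` depends on the term but not on `h`, which is what allows a
test word to be chosen afterwards. -/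
theorem ExtTerm.exists_card_le_blockMap_eval (hκ : ∀ n u, σ n u ≠ u → κ u = n) (s : ExtTerm A) :
    ∃ N, ∀ h : ℕ → List A, ∃ B : Finset ℕ, B.card ≤ N ∧ ∀ n ∉ B,
      blockMap a (σ n) (ExtTerm.eval h s) = ExtTerm.eval (blockMap a (σ n) ∘ h) s := by
  have fix : ∀ n u, n ≠ κ u → σ n u = u := fun n u hn => by
    by_contra hu
    exact hn (hκ n u hu).symm
  induction s with
  | nil =>
    refine ⟨1, fun h => ⟨{κ []}, by simp, fun n hn => ?_⟩⟩
    simpa [ExtTerm.eval, blockMap, blockMapAux] using fix n [] (by simpa using hn)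
  | cons v s ih =>
    obtain ⟨N, hN⟩ := ih
    refine ⟨N + 5, fun h => ?_⟩
    obtain ⟨B, hB, hs⟩ := hN h
    set x := Sum.elim h (fun l => [l]) v with hx
    set y := ExtTerm.eval h s with hy
    -- Three exclusions come from the cut between `x` and `y`. The other two make the map fix `x`
    -- when it is a single letter: `σ n [] = []` is needed for the letter `a`, `σ n x = x` for any
    -- other.
    refine ⟨B ∪ {κ (lastBlock a [] x), κ (firstBlock a y),
      κ (lastBlock a [] x ++ firstBlock a y), κ [], κ x}, ?_, fun n hn => ?_⟩
    · exact (Finset.card_union_le _ _).trans (Nat.add_le_add hB Finset.card_le_five)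
    · simp only [Finset.mem_union, Finset.mem_insert, Finset.mem_singleton, not_or] at hn
      obtain ⟨hnB, h₁, h₂, h₃, h₄, h₅⟩ := hn
      have hxy : ExtTerm.eval h (v :: s) = x ++ y := by simp [ExtTerm.eval, hx, hy]
      have hv : blockMap a (σ n) x = Sum.elim (blockMap a (σ n) ∘ h) (fun l => [l]) v := by
        rcases v with v | l
        · simp [hx]
        · have hl := fix n _ h₅
          have h0 := fix n _ h₄
          by_cases hla : l = a
          · simp [hx, blockMap, blockMapAux, hla, h0]
          · simpa [hx, blockMap, blockMapAux, hla] using hl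
      rw [hxy, blockMap_append (fix n _ h₁) (fix n _ h₂) (fix n _ h₃), hv, hs n hnB]
      simp [ExtTerm.eval]

theorem Formula.exists_card_le_commutes (a : A) (hκ : ∀ n u, σ n u ≠ u → κ u = n)
    (f : Formula A) :
    ∃ N, ∀ h : ℕ → List A, ∃ B : Finset ℕ, B.card ≤ N ∧ ∀ n ∉ B, ∀ α, f.HasAtom α →
      α.Commutes a (σ n) h := by
  have key : ∀ P Q : (ℕ → List A) → ℕ → Prop,
      (∃ N, ∀ h, ∃ B : Finset ℕ, B.card ≤ N ∧ ∀ n ∉ B, P h n) →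
      (∃ N, ∀ h, ∃ B : Finset ℕ, B.card ≤ N ∧ ∀ n ∉ B, Q h n) →
      ∃ N, ∀ h, ∃ B : Finset ℕ, B.card ≤ N ∧ ∀ n ∉ B, P h n ∧ Q h n := by
    rintro P Q ⟨N, hN⟩ ⟨M, hM⟩
    refine ⟨N + M, fun h => ?_⟩
    obtain ⟨B, hB, hP⟩ := hN h
    obtain ⟨C, hC, hQ⟩ := hM h
    refine ⟨B ∪ C, (Finset.card_union_le _ _).trans (Nat.add_le_add hB hC), fun n hn => ?_⟩
    rw [Finset.mem_union, not_or] at hn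
    exact ⟨hP n hn.1, hQ n hn.2⟩
  induction f with
  | atom α =>
    suffices ∃ N, ∀ h : ℕ → List A, ∃ B : Finset ℕ, B.card ≤ N ∧ ∀ n ∉ B,
        α.Commutes a (σ n) h by
      simpa [Formula.HasAtom] using this
    cases α with
    | mem s L => exact ExtTerm.exists_card_le_blockMap_eval hκ s
    | len l₁ l₂ => exact ⟨0, fun h => ⟨∅, by simp [Atom.Commutes]⟩⟩
    | eq s t =>
      exact key _ _ (ExtTerm.exists_card_le_blockMap_eval hκ s)
        (ExtTerm.exists_card_le_blockMap_eval hκ t)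
  | not f ih => exact ih
  | and f g ihf ihg | or f g ihf ihg | imp f g ihf ihg | iff f g ihf ihg =>
    obtain ⟨N, hN⟩ := key _ _ ihf ihg
    refine ⟨N, fun h => ?_⟩
    obtain ⟨B, hB, H⟩ := hN h
    exact ⟨B, hB, fun n hn α hα => hα.elim ((H n hn).1 α) ((H n hn).2 α)⟩

/-- Among sufficiently many block maps `blockMap a (σ n)` that respect the membership and length
atoms of a formula, one preserves its truth. -/
theorem Formula.exists_holds_blockMap (a : A) (hκ : ∀ n u, σ n u ≠ u → κ u = n)
    (hinv : ∀ n, Function.Involutive (σ n)) (ha : ∀ n u, a ∉ u → a ∉ σ n u) (f : Formula A)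
    (hmem : ∀ s L, f.HasAtom (.mem s L) → ∀ n w, blockMap a (σ n) w ∈ L ↔ w ∈ L)
    (hlen : ∀ l₁ l₂, f.HasAtom (.len l₁ l₂) → ∀ n u, (σ n u).length = u.length) :
    ∃ N, ∀ h : ℕ → List A, f.Holds h → ∃ n < N, f.Holds (blockMap a (σ n) ∘ h) := by
  obtain ⟨N, hN⟩ := f.exists_card_le_commutes a hκ
  refine ⟨N + 1, fun h hf => ?_⟩
  obtain ⟨B, hB, H⟩ := hN h
  -- Pigeonhole: at most `N` of the `N + 1` indices are bad.
  obtain ⟨n, hn, hnB⟩ : ∃ n ∈ Finset.range (N + 1), n ∉ B :=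
    Finset.exists_mem_notMem_of_card_lt_card (by simpa using Nat.lt_succ_of_le hB)
  refine ⟨n, Finset.mem_range.1 hn, (f.holds_congr fun α hα => ?_).1 hf⟩
  have hc := H n hnB α hα
  cases α with
  | mem s L =>
    simp only [Atom.Commutes] at hc
    simp only [Atom.Holds, ← hc, hmem s L hα n]
  | len l₁ l₂ =>
    have hl := hlen l₁ l₂ hα n
    have : ∀ l : LenTerm A, l.eval (blockMap a (σ n) ∘ h) = l.eval h := fun l => by
      have ht : ∀ t : BasicTerm A, (BasicTerm.eval (blockMap a (σ n) ∘ h) t).length =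
          (BasicTerm.eval h t).length := by
        rintro (v | w)
        · exact length_blockMap hl _
        · rfl
      simp only [LenTerm.eval, ht]
    simp only [Atom.Holds, this]
  | eq s t =>
    simp only [Atom.Holds, ← hc.1, ← hc.2]
    exact (blockMap_involutive (hinv n) (ha n)).injective.eq_iff.symm

end Transfer

/-! ### Idempotent powers and regular languages -/

section Regular

variable {A : Type*}

theorem exists_pos_iterate_idempotent {σ : Type*} [Finite σ] (g : σ → σ) :
    ∃ p, 0 < p ∧ ∀ k, g^[p * (k + 1)] = g^[p] := by
  obtain ⟨m, n, hmn, h⟩ := Finite.exists_ne_map_eq_of_infinite (fun n : ℕ => g^[n])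
  wlog hlt : m < n generalizing m n
  · exact this n m hmn.symm h.symm (by omega)
  obtain ⟨d, rfl⟩ := Nat.exists_eq_add_of_lt hlt
  have step : ∀ j, m ≤ j → g^[j + (d + 1)] = g^[j] := fun j hj => by
    obtain ⟨i, rfl⟩ := Nat.exists_eq_add_of_le hj
    rw [show m + i + (d + 1) = i + (m + d + 1) by ring, Function.iterate_add g i,
      show m + i = i + m by ring, Function.iterate_add g i]
    exact congrArg (g^[i] ∘ ·) h.symm
  have steps : ∀ k j, m ≤ j → g^[j + (d + 1) * k] = g^[j] := fun k => by
    induction k with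
    | zero => simp
    | succ k ih =>
      intro j hj
      rw [show j + (d + 1) * (k + 1) = j + (d + 1) * k + (d + 1) by ring,
        step _ (by omega), ih j hj]
  -- The iterates have period `d + 1` from exponent `m` on; this `p` is a multiple of the period and
  -- at least `m`.
  refine ⟨(d + 1) * (m + 1), by positivity, fun k => ?_⟩
  rw [show (d + 1) * (m + 1) * (k + 1) = (d + 1) * (m + 1) + (d + 1) * ((m + 1) * k) by ring]
  exact steps _ _ (by nlinarith)

/-- Some positive power of a letter is idempotent in the syntactic monoid of a regular
language. -/
theorem _root_.Language.IsRegular.exists_replicate_mem_iff {L : Language A} (hL : L.IsRegular)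
    (b : A) : ∃ p, 0 < p ∧ ∀ k s t,
      (s ++ replicate (p * (k + 1)) b ++ t ∈ L ↔ s ++ replicate p b ++ t ∈ L) := by
  obtain ⟨σ, _, M, rfl⟩ := hL
  obtain ⟨p, hp, h⟩ := exists_pos_iterate_idempotent (fun q => M.step q b)
  have hrep : ∀ n q, M.evalFrom q (replicate n b) = (fun q => M.step q b)^[n] q := fun n => by
    induction n with
    | zero => simp
    | succ n ih => intro q; simp [replicate_succ, ih]
  refine ⟨p, hp, fun k s t => ?_⟩
  simp only [DFA.mem_accepts, DFA.eval, DFA.evalFrom_of_append, hrep, h]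

end Regular

/-! ### Transpositions of two words -/

section Swap

variable {A : Type*} [DecidableEq A]

theorem swap_involutive (u v : List A) : Function.Involutive (Equiv.swap u v) := fun w => by
  rw [← Equiv.trans_apply, Equiv.swap_swap, Equiv.refl_apply]

theorem eq_or_eq_of_swap_apply_ne_self {u v w : List A} (h : Equiv.swap u v w ≠ w) : w = u ∨ w = v := by
  by_contra! hw
  exact h (Equiv.swap_apply_of_ne_of_ne hw.1 hw.2)

theorem notMem_swap {a : A} {u v : List A} (hu : a ∉ u) (hv : a ∉ v) (w : List A)
    (hw : a ∉ w) : a ∉ Equiv.swap u v w := by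
  by_cases h₁ : w = u
  · simpa [h₁] using hv
  by_cases h₂ : w = v
  · simpa [h₂] using hu
  · rwa [Equiv.swap_apply_of_ne_of_ne h₁ h₂]

theorem length_swap {u v : List A} (huv : u.length = v.length) (w : List A) :
    (Equiv.swap u v w).length = w.length := by
  by_cases h₁ : w = u
  · simp [h₁, huv]
  by_cases h₂ : w = v
  · simp [h₂, huv]
  · rw [Equiv.swap_apply_of_ne_of_ne h₁ h₂]

/-- The hypothesis says that `u` and `v` are syntactically congruent for `L`; any other word is
fixed. -/
theorem append_swap_append_mem_iff {L : Language A} {u v : List A}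
    (h : ∀ s t, s ++ u ++ t ∈ L ↔ s ++ v ++ t ∈ L) (w s t : List A) :
    s ++ Equiv.swap u v w ++ t ∈ L ↔ s ++ w ++ t ∈ L := by
  by_cases h₁ : w = u
  · rw [h₁, Equiv.swap_apply_left, h]
  by_cases h₂ : w = v
  · rw [h₂, Equiv.swap_apply_right, h]
  · rw [Equiv.swap_apply_of_ne_of_ne h₁ h₂]

end Swap

/-! ### The two separating languages -/

section Languages

variable {Λ : Type*} {a b c : Λ}

theorem Family.LE.expressible {F₁ F₂ : Family Λ} (h : F₁.LE F₂) {S : Finset Λ} {L : Language Λ}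
    (hL : StringLogic.Expressible (F₁ S) L) : F₂.Expressible L := by
  obtain ⟨f, hf, x, hx, rfl⟩ := hL
  obtain ⟨S₂, h₂⟩ := h S
  obtain ⟨f', hf', x', hx', heq⟩ := h₂ f hf x hx
  exact ⟨S₂, f', hf', x', hx', heq.symm⟩

theorem forall_mem_of_mem_expressed {S : Finset Λ} {f : Formula S} {x : ℕ} {w : List Λ}
    (hw : w ∈ f.expressed x) : ∀ l ∈ w, l ∈ S := by
  obtain ⟨h, -, rfl⟩ := hw
  intro l hl
  obtain ⟨s, -, rfl⟩ := List.mem_map.1 hl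
  exact s.2

/-- The test word is `b^2 a b^3 a ⋯ b^(N+1) a c`: whichever swap preserves the formula turns some
block into a power of `c`, while words of the language contain `c` only once. -/
theorem weLen_not_expressible_abStarC [DecidableEq Λ] (hab : a ≠ b) (hac : a ≠ c) (hbc : b ≠ c) :
    ¬ weLen.Expressible (abStarC a b c) := by
  rintro ⟨S, f, hf, x, -, hL⟩
  have hS : ∀ l ∈ [a, b, c], l ∈ S := by
    refine forall_mem_of_mem_expressed (f := f) (x := x) ?_
    rw [hL]
    exact ⟨[a, b], by simp, rfl⟩
  simp only [mem_cons, not_mem_nil, or_false, forall_eq_or_imp, forall_eq] at hS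
  obtain ⟨haS, hbS, hcS⟩ := hS
  lift a to S using haS
  lift b to S using hbS
  lift c to S using hcS
  replace hab : a ≠ b := fun h => hab (congrArg _ h)
  replace hac : a ≠ c := fun h => hac (congrArg _ h)
  replace hbc : b ≠ c := fun h => hbc (congrArg _ h)
  obtain ⟨N, hN⟩ := f.exists_holds_blockMap a
    -- Equal lengths keep the length atoms true; exponents of at least 2 make the swapped block
    -- alone exceed the single permitted `c`.
    (σ := fun n => Equiv.swap (replicate (n + 2) b) (replicate (n + 2) c))
    (κ := fun u => u.length - 2)
    (fun n u hu => by rcases eq_or_eq_of_swap_apply_ne_self hu with rfl | rfl <;> simp)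
    (fun n => swap_involutive _ _)
    (fun n => notMem_swap (by simp [hab]) (by simp [hac]))
    (fun s L hα => by simpa [Atom.IsWE, Atom.IsLEN] using hf _ hα)
    (fun _ _ _ n => length_swap (by simp))
  obtain ⟨h, hh, hx⟩ : (((range N).flatMap (fun n => replicate (n + 2) b ++ [a]) ++ [c]).map
      Subtype.val : List Λ) ∈ f.expressed x := by
    rw [hL]
    refine ⟨((range N).flatMap (fun n => replicate (n + 2) b ++ [a])).map Subtype.val, ?_, by simp⟩
    simp only [mem_map, mem_flatMap, mem_append, mem_replicate, mem_singleton]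
    rintro _ ⟨l, ⟨n, -, hl⟩, rfl⟩
    rcases hl with hl | rfl
    · exact .inr (congrArg _ hl.2)
    · exact .inl rfl
  replace hx := Subtype.val_injective.list_map hx
  obtain ⟨n, hn, hn'⟩ := hN h hh
  obtain ⟨v, hv, hvc⟩ : (blockMap a
      (Equiv.swap (replicate (n + 2) b) (replicate (n + 2) c)) (h x)).map Subtype.val ∈
        abStarC a.1 b.1 c.1 := by
    rw [← hL]
    exact ⟨_, hn', rfl⟩
  rw [← hx, blockMap_flatMap_append _ _ (by simp [hab])] at hvc
  have hcount : v.count c.1 = 0 := by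
    refine count_eq_zero.2 fun hc => ?_
    rcases hv _ hc with h | h
    · exact hac (Subtype.ext h.symm)
    · exact hbc (Subtype.ext h.symm)
  have hle : (replicate (n + 2) c).Sublist ((range N).flatMap fun i =>
      Equiv.swap (replicate (n + 2) b) (replicate (n + 2) c) (replicate (i + 2) b) ++ [a]) := by
    obtain ⟨l₁, l₂, hl⟩ := append_of_mem (List.mem_range.2 hn)
    simp [hl]
  have := (hle.map Subtype.val).count_le c.1
  have htotal := congrArg (count c.1) hvc
  rw [map_append, count_append, count_append, hcount, count_singleton_self] at htotal
  rw [ map_replicate, count_replicate_self] at this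
  omega

/-- In the test word `U c a^|U|`, the part `U` contains a candidate block for each `n < N`, whereas
after it only the block `c` and empty blocks occur, which are all fixed. Hence the swap lengthens
the left half alone, and `c` is no longer central. -/
theorem weReg_not_expressible_centralC [DecidableEq Λ] (hab : a ≠ b) (hac : a ≠ c) (hbc : b ≠ c) :
    ¬ weReg.Expressible (centralC a b c) := by
  rintro ⟨S, f, hf, x, -, hL⟩
  have hS : ∀ l ∈ [a, c, b], l ∈ S := by
    refine forall_mem_of_mem_expressed (f := f) (x := x) ?_
    rw [hL]
    exact ⟨[a], [b], by simp, by simp, rfl, rfl⟩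
  simp only [mem_cons, not_mem_nil, or_false, forall_eq_or_imp, forall_eq] at hS
  obtain ⟨haS, hcS, hbS⟩ := hS
  lift a to S using haS
  lift b to S using hbS
  lift c to S using hcS
  replace hab : a ≠ b := fun h => hab (congrArg _ h)
  replace hac : a ≠ c := fun h => hac (congrArg _ h)
  replace hbc : b ≠ c := fun h => hbc (congrArg _ h)
  -- One exponent `p` works for all regular languages in `f`, because the property passes to
  -- positive multiples of `p`.
  obtain ⟨p, hp, hfp⟩ := f.exists_pos_forall_atom (Q := fun α => α.IsWE ∨ α.IsREG)
    (P := fun α p => ∀ s L, α = .mem s L → ∀ k s t,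
      (s ++ replicate (p * (k + 1)) b ++ t ∈ L ↔ s ++ replicate p b ++ t ∈ L))
    (fun α hα => by
      cases α with
      | mem s L =>
        obtain ⟨p, hp, h⟩ := (show L.IsRegular by
          simpa [Atom.IsWE, Atom.IsREG] using hα).exists_replicate_mem_iff b
        refine ⟨p, hp, fun s' L' e => ?_⟩
        cases e
        exact h
      | len => exact ⟨1, one_pos, nofun⟩
      | eq => exact ⟨1, one_pos, nofun⟩)
    (fun α p q hq h s L e k s' t => by
      obtain ⟨q, rfl⟩ := Nat.exists_eq_succ_of_ne_zero hq.ne'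
      have h₁ := h s L e ((q + 1) * (k + 1) - 1) s' t
      rw [Nat.sub_add_cancel (Nat.mul_pos q.succ_pos k.succ_pos)] at h₁
      rw [mul_assoc, h₁, h s L e q s' t])
    hf
  set σ : ℕ → List S → List S := fun n =>
    -- The multipliers `2n + 2` and `2n + 3` are positive, give disjoint pairs for different `n`,
    -- and both return `n` under halving (rounded down) and subtracting 1, which is the `κ` below.
    Equiv.swap (replicate (p * (2 * n + 2)) b) (replicate (p * (2 * n + 3)) b)
  obtain ⟨N, hN⟩ := f.exists_holds_blockMap a (σ := σ)
    (κ := fun u => u.length / p / 2 - 1)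
    (fun n u hu => by
      rcases eq_or_eq_of_swap_apply_ne_self hu with rfl | rfl
      all_goals
        simp only [length_replicate, Nat.mul_div_cancel_left _ hp]
        omega)
    (fun n => swap_involutive _ _)
    (fun n => notMem_swap (by simp [hab]) (by simp [hab]))
    (fun s L hα n => blockMap_mem_iff (append_swap_append_mem_iff fun s' t => by
      rw [hfp _ hα s L rfl (2 * n + 1), hfp _ hα s L rfl (2 * n + 2)]))
    (fun l₁ l₂ hα => by simpa [Atom.IsWE, Atom.IsREG] using hf _ hα)
  set U := (range N).flatMap (fun n => replicate (p * (2 * n + 2)) b ++ [a]) with hU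
  obtain ⟨h, hh, hx⟩ : ((U ++ c :: replicate U.length a).map Subtype.val : List Λ) ∈
      f.expressed x := by
    rw [hL]
    refine ⟨U.map Subtype.val, (replicate U.length a).map Subtype.val, ?_, ?_, by simp, by simp⟩
    · simp only [hU, mem_map, mem_flatMap, mem_append, mem_replicate, mem_singleton]
      rintro _ ⟨l, ⟨n, -, hl⟩, rfl⟩
      rcases hl with hl | rfl
      · exact .inr (.inl (congrArg _ hl.2))
      · exact .inl rfl
    · simp +contextual
  replace hx := Subtype.val_injective.list_map hx
  obtain ⟨n, hn, hn'⟩ := hN h hh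
  obtain ⟨u, v, -, -, huv, heq⟩ : (blockMap a (σ n) (h x)).map Subtype.val ∈
        centralC a.1 b.1 c.1 := by
    rw [← hL]
    exact ⟨_, hn', rfl⟩
  have hlt : 0 < p * (2 * n + 2) ∧ 0 < p * (2 * n + 3) := ⟨by positivity, by positivity⟩
  have h0 : σ n [] = [] := Equiv.swap_apply_of_ne_of_ne
    (fun e => by have := congrArg length e; simp at this; omega)
    (fun e => by have := congrArg length e; simp at this; omega)
  have hc : σ n [c] = [c] := Equiv.swap_apply_of_ne_of_ne
    (fun e => hbc (eq_of_mem_replicate (e ▸ mem_singleton_self c)).symm)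
    (fun e => hbc (eq_of_mem_replicate (e ▸ mem_singleton_self c)).symm)
  have hself : σ n (replicate (p * (2 * n + 2)) b) = replicate (p * (2 * n + 3)) b :=
    Equiv.swap_apply_left _ _
  have hother : ∀ i ≠ n, σ n (replicate (p * (2 * i + 2)) b) = replicate (p * (2 * i + 2)) b :=
    fun i hi => Equiv.swap_apply_of_ne_of_ne
      (fun e => by
        have := Nat.eq_of_mul_eq_mul_left hp (by simpa using congrArg length e)
        omega)
      (fun e => by
        have := Nat.eq_of_mul_eq_mul_left hp (by simpa using congrArg length e)
        omega)
  rw [← hx, hU, blockMap_flatMap_append _ _ (by simp [hab]), ← hU,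
    blockMap_cons_replicate hac.symm h0 hc] at heq
  set U' := (range N).flatMap (fun i => σ n (replicate (p * (2 * i + 2)) b) ++ [a]) with hU'
  have hUU' : U.length < U'.length := by
    rw [hU, hU', length_flatMap, length_flatMap]
    refine List.sum_lt_sum _ _ (fun i _ => ?_) ⟨n, List.mem_range.2 hn, ?_⟩
    · by_cases hi : i = n
      · rw [hi, hself]
        simp
        gcongr
        omega
      · rw [hother i hi]
    · rw [hself]
      simp [hp]
  have hcU' : c ∉ U' := by
    simp only [hU', mem_flatMap, mem_append, mem_singleton, not_exists, not_and, not_or]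
    refine fun i _ => ⟨fun hmem => ?_, hac.symm⟩
    by_cases hi : i = n
    · rw [hi, hself] at hmem
      exact hbc (eq_of_mem_replicate hmem).symm
    · rw [hother i hi] at hmem
      exact hbc (eq_of_mem_replicate hmem).symm
  -- The image contains `c` exactly once, so its factorization around `c` is unique, and the halves
  -- have lengths `U'.length` and `U.length`.
  rw [map_append, map_cons, append_assoc, singleton_append,
    append_cons_inj_of_notMem
      (by rwa [mem_map_of_injective Subtype.val_injective])
      (by rw [mem_map_of_injective Subtype.val_injective]; simp [hac.symm])] at heq
  have h₁ := congrArg length heq.1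
  have h₂ := congrArg length heq.2.2
  simp only [length_map, length_replicate] at h₁ h₂
  omega

/-- A deterministic automaton for `{a,b}*c`: the states are `0` (reading), `1` (accepting) and
`2` (rejecting). -/
def abStarCDFA {A : Type*} [DecidableEq A] (a b c : A) : DFA A (Fin 3) where
  step q l := if q = 0 then (if l = a ∨ l = b then 0 else if l = c then 1 else 2) else 2
  start := 0
  accept := {1}

/-- State `2` is a sink and every letter leads from `1` to `2`, so only runs from state `0` need
induction. -/
theorem mem_accepts_abStarCDFA {A : Type*} [DecidableEq A] {a b c : A} (hac : a ≠ c)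
    (hbc : b ≠ c) (w : List A) :
    w ∈ (abStarCDFA a b c).accepts ↔ ∃ v, (∀ l ∈ v, l = a ∨ l = b) ∧ w = v ++ [c] := by
  have h2 : ∀ w, (abStarCDFA a b c).evalFrom 2 w = 2 := fun w => by
    induction w with
    | nil => rfl
    | cons l w ih => simpa [abStarCDFA] using ih
  have h1 : ∀ w, (abStarCDFA a b c).evalFrom 1 w = 1 ↔ w = [] := fun w => by
    cases w with
    | nil => simp
    | cons l w =>
      have : (abStarCDFA a b c).step 1 l = 2 := by simp [abStarCDFA]
      simp [this, h2]
  change (abStarCDFA a b c).evalFrom 0 w = 1 ↔ _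
  induction w with
  | nil => simp
  | cons l w ih =>
    by_cases hl : l = a ∨ l = b
    · have : (abStarCDFA a b c).step 0 l = 0 := by simp [abStarCDFA, hl]
      rw [DFA.evalFrom_cons, this, ih]
      constructor
      · rintro ⟨v, hv, rfl⟩
        exact ⟨l :: v, by simpa using ⟨hl, hv⟩, rfl⟩
      · rintro ⟨_ | ⟨m, v⟩, hv, he⟩
        · simp only [nil_append, cons.injEq] at he
          rcases hl with hl | hl
          · exact absurd (hl.symm.trans he.1) hac
          · exact absurd (hl.symm.trans he.1) hbc
        · simp only [cons_append, cons.injEq] at he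
          exact ⟨v, fun k hk => hv k (mem_cons_of_mem _ hk), he.2⟩
    · have hr : (∃ v, (∀ l ∈ v, l = a ∨ l = b) ∧ l :: w = v ++ [c]) ↔ l = c ∧ w = [] := by
        constructor
        · rintro ⟨_ | ⟨m, v⟩, hv, he⟩
          · simpa using he
          · simp only [cons_append, cons.injEq] at he
            exact absurd (he.1 ▸ hv m mem_cons_self) hl
        · rintro ⟨rfl, rfl⟩
          exact ⟨[], by simp⟩
      rw [hr, DFA.evalFrom_cons]
      by_cases hlc : l = c
      · have : (abStarCDFA a b c).step 0 l = 1 := by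
          simp only [abStarCDFA, if_true, if_neg hl, if_pos hlc]
        rw [this, h1]
        simp [hlc]
      · have : (abStarCDFA a b c).step 0 l = 2 := by
          simp only [abStarCDFA, if_true, if_neg hl, if_neg hlc]
        rw [this, h2]
        simp [hlc]

theorem weReg_expressible_abStarC [DecidableEq Λ] (hac : a ≠ c) (hbc : b ≠ c) {S : Finset Λ}
    (ha : a ∈ S) (hb : b ∈ S) (hc : c ∈ S) : Expressible (weReg S) (abStarC a b c) := by
  lift a to S using ha
  lift b to S using hb
  lift c to S using hc
  replace hac : a ≠ c := fun h => hac (congrArg _ h)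
  replace hbc : b ≠ c := fun h => hbc (congrArg _ h)
  refine ⟨.atom (.mem [Sum.inl 0] (abStarCDFA a b c).accepts), ?_, 0, ?_, ?_⟩
  · rintro α rfl
    exact .inr ⟨Fin 3, inferInstance, _, rfl⟩
  · exact ⟨_, rfl, by simp [Atom.HasVar]⟩
  · ext w
    simp only [Formula.expressed, Formula.Holds, Atom.Holds, ExtTerm.eval, flatMap_cons,
      flatMap_nil, append_nil, Sum.elim_inl, mem_accepts_abStarCDFA hac hbc]
    constructor
    · rintro ⟨h, ⟨v, hv, hh⟩, rfl⟩
      refine ⟨v.map Subtype.val, fun l hl => ?_, by simp [hh]⟩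
      obtain ⟨m, hm, rfl⟩ := List.mem_map.1 hl
      exact (hv m hm).imp (congrArg _) (congrArg _)
    · rintro ⟨v, hv, rfl⟩
      lift v to List S using fun l hl => by
        rcases hv l hl with rfl | rfl
        exacts [a.2, b.2]
      refine ⟨fun _ => v ++ [c], ⟨v, fun l hl => ?_, rfl⟩, by simp⟩
      exact (hv l (mem_map_of_mem hl)).imp Subtype.ext Subtype.ext

theorem weLen_expressible_centralC [DecidableEq Λ] :
    Expressible (weLen ({a, b, c} : Finset Λ)) (centralC a b c) := by
  have hc : c ∈ ({a, b, c} : Finset Λ) := by simp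
  refine ⟨.and (.atom (.eq [Sum.inl 0] [Sum.inl 1, Sum.inr ⟨c, hc⟩, Sum.inl 2]))
    (.atom (.len ⟨0, [(1, Sum.inl 1)]⟩ ⟨0, [(1, Sum.inl 2)]⟩)), ?_, 0, ?_, ?_⟩
  · rintro α (rfl | rfl)
    exacts [.inl trivial, .inr trivial]
  · exact ⟨_, .inl rfl, by simp [Atom.HasVar]⟩
  · have hS : ∀ v : List ({a, b, c} : Finset Λ), ∀ l ∈ v.map Subtype.val,
        l = a ∨ l = b ∨ l = c := fun v l hl => by
      obtain ⟨m, -, rfl⟩ := List.mem_map.1 hl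
      have := m.2
      simpa only [Finset.mem_insert, Finset.mem_singleton] using this
    ext w
    simp only [Formula.expressed, Formula.Holds, Atom.Holds, ExtTerm.eval, flatMap_cons,
      flatMap_nil, append_nil, Sum.elim_inl, Sum.elim_inr, LenTerm.eval, BasicTerm.eval, map_cons,
      map_nil, sum_cons, sum_nil, one_mul, add_zero, zero_add, Nat.cast_inj]
    constructor
    · rintro ⟨h, ⟨h₀, hl⟩, rfl⟩
      exact ⟨_, _, hS (h 1), hS (h 2), by simpa using hl, by simp [h₀]⟩
    · rintro ⟨u, v, hu, hv, huv, rfl⟩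
      lift u to List ({a, b, c} : Finset Λ) using fun l hl => by simpa using hu l hl
      lift v to List ({a, b, c} : Finset Λ) using fun l hl => by simpa using hv l hl
      refine ⟨fun i => if i = 0 then u ++ ⟨c, hc⟩ :: v else if i = 1 then u else v, ?_, by simp⟩
      simpa using huv

theorem weLen_le_weRegLen : (weLen (Λ := Λ)).LE weRegLen := fun S =>
  ⟨S, fun f hf x hx => ⟨f, fun α hα => (hf α hα).imp id .inr, x, hx, rfl⟩⟩

theorem weReg_le_weRegLen : (weReg (Λ := Λ)).LE weRegLen := fun S =>
  ⟨S, fun f hf x hx => ⟨f, fun α hα => (hf α hα).imp id .inl, x, hx, rfl⟩⟩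

end Languages

end StringLogic

theorem mainTheorem5 {Λ : Type*} [DecidableEq Λ] (a b c : Λ)
    (hab : a ≠ b) (hac : a ≠ c) (hbc : b ≠ c) :
    -- (1)
    ((∀ S : Finset Λ, a ∈ S → b ∈ S → c ∈ S →
        StringLogic.Expressible (StringLogic.weReg S) (StringLogic.abStarC a b c)) ∧
      ¬ StringLogic.weLen.Expressible (StringLogic.abStarC a b c)) ∧
    -- (2)
    (StringLogic.Expressible (StringLogic.weLen ({a, b, c} : Finset Λ))
        (StringLogic.centralC a b c) ∧
      ¬ StringLogic.weReg.Expressible (StringLogic.centralC a b c)) ∧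
    -- the classes of expressible languages are incomparable, and so are the families
    (¬ (StringLogic.weLen (Λ := Λ)).languages ⊆ StringLogic.weReg.languages ∧
      ¬ (StringLogic.weReg (Λ := Λ)).languages ⊆ StringLogic.weLen.languages) ∧
    (¬ (StringLogic.weLen (Λ := Λ)).LE StringLogic.weReg ∧
      ¬ (StringLogic.weReg (Λ := Λ)).LE StringLogic.weLen) ∧
    -- both are strictly below `WE+REG+LEN`
    (StringLogic.weLen (Λ := Λ)).LT StringLogic.weRegLen ∧
    (StringLogic.weReg (Λ := Λ)).LT StringLogic.weRegLen := by
  have h₁ : ∀ S : Finset Λ, a ∈ S → b ∈ S → c ∈ S →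
      StringLogic.Expressible (StringLogic.weReg S) (StringLogic.abStarC a b c) :=
    fun _ => StringLogic.weReg_expressible_abStarC hac hbc
  have h₁' := StringLogic.weLen_not_expressible_abStarC hab hac hbc
  have h₂ := StringLogic.weLen_expressible_centralC (a := a) (b := b) (c := c)
  have h₂' := StringLogic.weReg_not_expressible_centralC hab hac hbc
  have h₁S := h₁ {a, b, c} (by simp) (by simp) (by simp)
  have hLen : ¬ (StringLogic.weLen (Λ := Λ)).LE StringLogic.weReg := fun h =>
    h₂' (StringLogic.Family.LE.expressible h h₂)
  have hReg : ¬ (StringLogic.weReg (Λ := Λ)).LE StringLogic.weLen := fun h =>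
    h₁' (StringLogic.Family.LE.expressible h h₁S)
  refine ⟨⟨h₁, h₁'⟩, ⟨h₂, h₂'⟩, ⟨fun h => h₂' (h ⟨_, h₂⟩), fun h => h₁' (h ⟨_, h₁S⟩)⟩, ⟨hLen, hReg⟩,
    ⟨StringLogic.weLen_le_weRegLen, fun h => ?_⟩, ⟨StringLogic.weReg_le_weRegLen, fun h => ?_⟩⟩
  -- Strictness: a language of the other subfamily is expressible in `WE+REG+LEN` and would be
  -- carried down by the reverse comparison.
  · obtain ⟨S, hS⟩ := StringLogic.Family.LE.expressible StringLogic.weReg_le_weRegLen h₁S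
    exact h₁' (StringLogic.Family.LE.expressible h.2 hS)
  · obtain ⟨S, hS⟩ := StringLogic.Family.LE.expressible StringLogic.weLen_le_weRegLen h₂
    exact h₂' (StringLogic.Family.LE.expressible h.2 hS)
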